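/- Let $K$ be a field of any characteristic, let $n_1\ge n_2\ge\cdots\ge n_r>0$ be integers, $n=n_1+\cdots+n_r$, and let $J_T\in \mathbf M(n)$ be the Jordan canonical form (ones on the superdiagonal) with Jordan cells of sizes $n_1,\dots,n_r$ in this order. Here $\mathbf M(m)$ is the algebra of $m\times m$ matrices over $K$. Let $f_1>f_2>\cdots>f_s$ be the distinct values among $n_1,\dots,n_r$ and let $m_j$ be the number of $k$ with $n_k=f_j$; $(m_1,\dots,m_s)$ is the multiplicity sequence. Decompose each $M\in\mathbf M(n)$ into blocks $M^{(kl)}$ of size $n_k\times n_l$ $(1\le k,l\le r)$. Let $N_1(M)$ be the $r\times r$ matrix whose $(k,l)$ entry is the $(1,1)$ entry of $M^{(kl)}$, and let $G_1(M),\dots,G_s(M)$ be the consecutive diagonal blocks of $N_1(M)$ of sizes $m_1,\dots,m_s$, so that $G_j(M)$ consists of the entries of $N_1(M)$ in the rows and columns $k$ with $n_k=f_j$. ($N_1(M)$ is the first diagonal block of the matrix $\widehat M$ whose $(i,j)$ block has as its $(k,l)$ entry the $(i,j)$ entry of $M^{(kl)}$.) Let $J\in\mathbf M(n)$ be a nilpotent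 matrix of Jordan type $(n_1,\dots,n_r)$, let $P$ be any invertible matrix with $J=PJ_TP^{-1}$ (for example $P=1$ if $J=J_T$), and let $C(J)=\{X\in\mathbf M(n) : XJ=JX\}$. Then $$\Phi: C(J)\to \mathbf M(m_1)\times\cdots\times\mathbf M(m_s),\qquad \Phi(M)=\bigl(G_1(P^{-1}MP),\dots,G_s(P^{-1}MP)\bigr),$$ is a surjective homomorphism of $K$-algebras, and its kernel is exactly the Jacobson radical of $C(J)$. -/

import Mathlib

/-!
Throughout, a partition (Young diagram) with `r` rows is a function `n : Fin r → ℕ`, weakly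
decreasing with positive values in the theorem; row `k` has `n k` boxes. Rows and columns are
numbered from `0`, so the first column of the diagram is column `0`.
-/

namespace JordanCommutator

/-- The boxes of the diagram with row lengths `n`: the box `⟨k, i⟩` is in row `k` and column `i`. -/
abbrev Box {r : ℕ} (n : Fin r → ℕ) : Type := (k : Fin r) × Fin (n k)

/-- The horizontal numbering of the boxes: the `i`-th box of row `k` gets the number
`n 0 + ⋯ + n (k - 1) + i`. -/
abbrev horizontal {r : ℕ} (n : Fin r → ℕ) : Box n ≃ Fin (∑ k, n k) := finSigmaFinEquiv

/-- The Jordan canonical form with cells of sizes `n 0, n 1, …`: the entry at two boxes `a, b` is `1`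
if `b` is next to and on the right of `a`, and `0` otherwise. -/
def jordanMatrix (K : Type*) [Field K] {r : ℕ} (n : Fin r → ℕ) :
    Matrix (Fin (∑ k, n k)) (Fin (∑ k, n k)) K :=
  Matrix.of fun a b =>
    let x := (horizontal n).symm a
    let y := (horizontal n).symm b
    if x.1 = y.1 ∧ (y.2 : ℕ) = (x.2 : ℕ) + 1 then 1 else 0

/-- The `(k, l)` block, of size `n k × n l`, of a matrix `M` decomposed according to `n`. -/
def block {K : Type*} [Field K] {r : ℕ} (n : Fin r → ℕ)
    (M : Matrix (Fin (∑ k, n k)) (Fin (∑ k, n k)) K) (k l : Fin r) :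
    Matrix (Fin (n k)) (Fin (n l)) K :=
  Matrix.of fun i j => M (horizontal n ⟨k, i⟩) (horizontal n ⟨l, j⟩)

/-- The `(i, j)` block of the rearranged matrix `M̂`: its `(k, l)` entry is the `(i, j)` entry of the
`(k, l)` block of `M`. Its rows are indexed by the boxes of column `i` of the diagram and its columns
by the boxes of column `j`. -/
def hatBlock {K : Type*} [Field K] {r : ℕ} (n : Fin r → ℕ)
    (M : Matrix (Fin (∑ k, n k)) (Fin (∑ k, n k)) K) (i j : ℕ) :
    Matrix {k : Fin r // i < n k} {k : Fin r // j < n k} K :=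
  Matrix.of fun k l => block n M k.1 l.1 ⟨i, k.2⟩ ⟨j, l.2⟩

/-- The coarse diagonal blocks of `M̂`. The first one is `coarseBlock n M 0`. -/
def coarseBlock {K : Type*} [Field K] {r : ℕ} (n : Fin r → ℕ)
    (M : Matrix (Fin (∑ k, n k)) (Fin (∑ k, n k)) K) (i : ℕ) :
    Matrix {k : Fin r // i < n k} {k : Fin r // i < n k} K :=
  hatBlock n M i i

/-- The number `s` of distinct parts. -/
def numParts {r : ℕ} (n : Fin r → ℕ) : ℕ := (Finset.univ.image n).card

/-- The distinct parts `f 0 > f 1 > ⋯ > f (s - 1)`, in decreasing order. -/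
def distinctPart {r : ℕ} (n : Fin r → ℕ) (j : Fin (numParts n)) : ℕ :=
  (Finset.univ.image n).orderEmbOfFin rfl (Fin.rev j)

/-- The rows whose length is the `j`-th distinct part. -/
def rowsOf {r : ℕ} (n : Fin r → ℕ) (j : Fin (numParts n)) : Finset (Fin r) :=
  Finset.univ.filter fun k => n k = distinctPart n j

/-- The multiplicity sequence: `multiplicity n j` is the multiplicity of the `j`-th distinct part. -/
def multiplicity {r : ℕ} (n : Fin r → ℕ) (j : Fin (numParts n)) : ℕ := (rowsOf n j).card

/-- The `j`-th diagonal block `G_j`, of size `m_j × m_j`, of the first coarse diagonal block of `M̂`: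
the rows and columns of that block which belong to the rows of length `f_j` of the diagram, in their
order (for weakly decreasing `n` these rows are consecutive). -/
def fineBlock {K : Type*} [Field K] {r : ℕ} (n : Fin r → ℕ) (hpos : ∀ k, 0 < n k)
    (M : Matrix (Fin (∑ k, n k)) (Fin (∑ k, n k)) K) (j : Fin (numParts n)) :
    Matrix (Fin (multiplicity n j)) (Fin (multiplicity n j)) K :=
  (coarseBlock n M 0).submatrix
    (fun a => ⟨(rowsOf n j).orderEmbOfFin rfl a, hpos _⟩)
    (fun b => ⟨(rowsOf n j).orderEmbOfFin rfl b, hpos _⟩)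

/-- The commutator algebra `C(J) = {X | X J = J X}`. -/
abbrev commutatorAlgebra {K : Type*} [Field K] {N : ℕ} (J : Matrix (Fin N) (Fin N) K) :
    Subalgebra K (Matrix (Fin N) (Fin N) K) :=
  Subalgebra.centralizer K {J}

end JordanCommutator

/-! After conjugation by `P`, a matrix `A` commutes with the shift `boxJordan`. Then every block of
`A` is constant along diagonals and zero below the main one, and its main diagonal vanishes when the
block has fewer rows than columns (`apply_eq_zero_of_lt`, `apply_diag`, `apply_zero_zero_of_lt`). So
taking (0,0) entries is multiplicative and gives a matrix that is block triangular by row length;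
its diagonal blocks `G_j` are therefore multiplicative too. Scalars on the square blocks commute
with the shift, which gives surjectivity. If all `G_j` vanish, `A` is strictly triangular once boxes
are ordered by column and then by decreasing row length, so the kernel is a nil ideal and lies in
the radical. Conversely, a surjection maps the radical into that of the target, which is zero
because a product of matrix algebras is semisimple. -/

namespace JordanCommutator

/-! ### Nil kernels and the Jacobson radical. -/

section RadicalKernel

/-- A left ideal of nilpotent elements lies in the Jacobson radical. -/
theorem le_ringJacobson_of_isNilpotent {R : Type*} [Ring R] (I : Ideal R)
    (hI : ∀ x ∈ I, IsNilpotent x) : I ≤ Ring.jacobson R := by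
  intro x hx
  rw [← Ideal.jacobson_bot, Ideal.mem_jacobson_iff]
  intro y
  obtain ⟨u, hu⟩ := (hI _ (I.mul_mem_left y hx)).isUnit_add_one
  refine ⟨(u⁻¹ : Rˣ), ?_⟩
  have h : (u⁻¹ : Rˣ).val * (y * x + 1) = 1 := by rw [← hu]; exact u.inv_mul
  rw [Submodule.mem_bot, ← h]
  noncomm_ring

/-- A surjection onto a semisimple ring whose kernel is nil has the Jacobson radical as its
kernel. -/
theorem ker_eq_ringJacobson {R S : Type*} [Ring R] [Ring S] [IsSemisimpleRing S] (f : R →+* S)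
    (hf : Function.Surjective f) (hnil : ∀ x, f x = 0 → IsNilpotent x) :
    RingHom.ker f = Ring.jacobson R := by
  refine le_antisymm (le_ringJacobson_of_isNilpotent _ fun x hx => hnil x hx) fun x hx => ?_
  have : RingHomSurjective f := ⟨hf⟩
  have h : f x ∈ Ring.jacobson S := Ring.le_comap_jacobson f hx
  rwa [IsSemisimpleRing.jacobson_eq_bot, Submodule.mem_bot] at h

/-- A matrix that is strictly triangular for a weight on the indices is nilpotent. -/
theorem isNilpotent_of_weight {ι K : Type*} [Fintype ι] [DecidableEq ι] [Semiring K]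
    (A : Matrix ι ι K) (w : ι → ℕ) (hA : ∀ a b, A a b ≠ 0 → w a < w b) : IsNilpotent A := by
  have key : ∀ m a b, (A ^ m) a b ≠ 0 → w a + m ≤ w b := by
    intro m
    induction m with
    | zero =>
      intro a b h
      rw [pow_zero, Matrix.one_apply] at h
      have : a = b := by by_contra hab; simp [hab] at h
      simp [this]
    | succ m ih =>
      intro a b h
      rw [pow_succ, Matrix.mul_apply] at h
      obtain ⟨c, -, hc⟩ := Finset.exists_ne_zero_of_sum_ne_zero h
      have h1 := ih a c (left_ne_zero_of_mul hc)
      have h2 := hA c b (right_ne_zero_of_mul hc)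
      omega
  -- A nonzero entry of this power would raise the weight beyond its maximum.
  refine ⟨Finset.univ.sup w + 1, ?_⟩
  ext a b
  by_contra h
  have h1 := key _ a b h
  have h2 := Finset.le_sup (f := w) (Finset.mem_univ b)
  omega

end RadicalKernel

/-! ### Rows of equal length. -/

section Rows

variable {r : ℕ} (n : Fin r → ℕ)

/-- The `a`-th row whose length is the `j`-th distinct part. -/
def rowAt (j : Fin (numParts n)) (a : Fin (multiplicity n j)) : Fin r :=
  (rowsOf n j).orderEmbOfFin rfl a

theorem length_rowAt (j : Fin (numParts n)) (a : Fin (multiplicity n j)) :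
    n (rowAt n j a) = distinctPart n j :=
  (Finset.mem_filter.1 ((rowsOf n j).orderEmbOfFin_mem rfl a)).2

theorem rowAt_injective (j : Fin (numParts n)) : Function.Injective (rowAt n j) :=
  ((rowsOf n j).orderEmbOfFin rfl).injective

theorem exists_rowAt (j : Fin (numParts n)) (k : Fin r) (hk : n k = distinctPart n j) :
    ∃ a, rowAt n j a = k := by
  have h : k ∈ Set.range ((rowsOf n j).orderEmbOfFin rfl) := by
    rw [Finset.range_orderEmbOfFin]
    simp [rowsOf, hk]
  exact h

theorem distinctPart_injective : Function.Injective (distinctPart n) := fun _ _ h =>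
  Fin.rev_injective (((Finset.univ.image n).orderEmbOfFin rfl).injective h)

theorem exists_distinctPart (k : Fin r) : ∃ j, n k = distinctPart n j := by
  have h : n k ∈ Set.range ((Finset.univ.image n).orderEmbOfFin rfl) := by
    rw [Finset.range_orderEmbOfFin]
    simp
  obtain ⟨i, hi⟩ := h
  refine ⟨Fin.rev (n := numParts n) i, hi.symm.trans ?_⟩
  exact congrArg _ (Fin.rev_rev (n := numParts n) i).symm

/-- A function supported on the rows of length `f_j` is summed along their enumeration. -/
theorem sum_eq_sum_rowAt {K : Type*} [AddCommMonoid K] (j : Fin (numParts n)) (f : Fin r → K)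
    (hf : ∀ k, n k ≠ distinctPart n j → f k = 0) : ∑ k, f k = ∑ a, f (rowAt n j a) := by
  refine (Fintype.sum_of_injective (rowAt n j) (rowAt_injective n j) _ _ ?_ ?_).symm
  · intro k hk
    exact hf k fun h => hk (exists_rowAt n j k h)
  · intro a
    rfl

/-- Square matrices on the rows of each length are the restrictions of one array. -/
theorem exists_array {K : Type*} [Zero K]
    (G : (j : Fin (numParts n)) → Matrix (Fin (multiplicity n j)) (Fin (multiplicity n j)) K) :
    ∃ g : Fin r → Fin r → K, ∀ j a b, g (rowAt n j a) (rowAt n j b) = G j a b := by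
  let e : ((j : Fin (numParts n)) × (Fin (multiplicity n j) × Fin (multiplicity n j))) →
      Fin r × Fin r := fun t => (rowAt n t.1 t.2.1, rowAt n t.1 t.2.2)
  -- The common length of the two rows recovers `j`, so distinct `G j` never prescribe the same
  -- entry.
  have he : Function.Injective e := by
    rintro ⟨j, a, b⟩ ⟨j', a', b'⟩ h
    obtain ⟨h1, h2⟩ := Prod.mk.inj h
    obtain rfl : j = j' := distinctPart_injective n (by
      rw [← length_rowAt n j a, ← length_rowAt n j' a']
      exact congrArg n h1)
    obtain rfl : a = a' := rowAt_injective n j h1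
    obtain rfl : b = b' := rowAt_injective n j h2
    rfl
  exact ⟨fun k l => Function.extend e (fun t => G t.1 t.2.1 t.2.2) 0 (k, l),
    fun j a b => he.extend_apply _ _ ⟨j, a, b⟩⟩

end Rows

/-! ### The centralizer of the Jordan matrix, entry by entry. -/

section BoxMatrices

variable {K : Type*} [Field K] {r : ℕ} {n : Fin r → ℕ}

/-- The Jordan matrix, with rows and columns indexed by the boxes. -/
def boxJordan (K : Type*) [Field K] {r : ℕ} (n : Fin r → ℕ) : Matrix (Box n) (Box n) K :=
  Matrix.of fun x y => if x.1 = y.1 ∧ (y.2 : ℕ) = (x.2 : ℕ) + 1 then 1 else 0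

theorem boxJordan_mul_apply (A : Matrix (Box n) (Box n) K) (k : Fin r) (i : Fin (n k))
    (y : Box n) : (boxJordan K n * A) ⟨k, i⟩ y =
      if h : (i : ℕ) + 1 < n k then A ⟨k, ⟨i + 1, h⟩⟩ y else 0 := by
  rw [Matrix.mul_apply]
  split_ifs with h
  · rw [Finset.sum_eq_single (⟨k, ⟨i + 1, h⟩⟩ : Box n)]
    · simp [boxJordan]
    · rintro ⟨l, j⟩ - hne
      have : ¬(k = l ∧ (j : ℕ) = i + 1) := by
        rintro ⟨rfl, hj⟩
        exact hne (by congr 1; exact Fin.ext hj)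
      simp [boxJordan, this]
    · simp
  · refine Finset.sum_eq_zero ?_
    rintro ⟨l, j⟩ -
    have : ¬(k = l ∧ (j : ℕ) = i + 1) := by
      rintro ⟨rfl, hj⟩
      exact h (hj ▸ j.2)
    simp [boxJordan, this]

theorem mul_boxJordan_apply_succ (A : Matrix (Box n) (Box n) K) (x : Box n) (l : Fin r) (j : ℕ)
    (h : j + 1 < n l) : (A * boxJordan K n) x ⟨l, ⟨j + 1, h⟩⟩ = A x ⟨l, ⟨j, by omega⟩⟩ := by
  rw [Matrix.mul_apply, Finset.sum_eq_single (⟨l, ⟨j, by omega⟩⟩ : Box n)]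
  · simp [boxJordan]
  · rintro ⟨k, i⟩ - hne
    have : ¬(k = l ∧ j = (i : ℕ)) := by
      rintro ⟨rfl, hj⟩
      exact hne (by congr 1; exact Fin.ext hj.symm)
    simp [boxJordan, this]
  · simp

theorem mul_boxJordan_apply_zero (A : Matrix (Box n) (Box n) K) (x : Box n) (l : Fin r)
    (h : 0 < n l) : (A * boxJordan K n) x ⟨l, ⟨0, h⟩⟩ = 0 := by
  rw [Matrix.mul_apply]
  exact Finset.sum_eq_zero fun y _ => by simp [boxJordan]

variable {A : Matrix (Box n) (Box n) K}

theorem apply_succ_succ (hA : Commute A (boxJordan K n)) {k l : Fin r} {i j : ℕ}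
    (hi : i + 1 < n k) (hj : j + 1 < n l) :
    A ⟨k, ⟨i + 1, hi⟩⟩ ⟨l, ⟨j + 1, hj⟩⟩ = A ⟨k, ⟨i, by omega⟩⟩ ⟨l, ⟨j, by omega⟩⟩ := by
  have h := congrFun (congrFun hA.eq ⟨k, ⟨i, by omega⟩⟩) ⟨l, ⟨j + 1, hj⟩⟩
  rw [mul_boxJordan_apply_succ, boxJordan_mul_apply, dif_pos hi] at h
  exact h.symm

/-- Sliding up the diagonal reaches column 0 at a positive row. There the entry is one of `boxJordan
* A`, hence of column 0 of `A * boxJordan`, which is zero. -/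
theorem apply_eq_zero_of_lt (hA : Commute A (boxJordan K n)) {k l : Fin r} {i j : ℕ}
    (hi : i < n k) (hj : j < n l) (hij : j < i) : A ⟨k, ⟨i, hi⟩⟩ ⟨l, ⟨j, hj⟩⟩ = 0 := by
  induction j generalizing i with
  | zero =>
    obtain ⟨i, rfl⟩ := Nat.exists_eq_succ_of_ne_zero hij.ne'
    have h := congrFun (congrFun hA.eq ⟨k, ⟨i, by omega⟩⟩) ⟨l, ⟨0, hj⟩⟩
    rw [mul_boxJordan_apply_zero, boxJordan_mul_apply, dif_pos hi] at h
    exact h.symm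
  | succ j ih =>
    obtain ⟨i, rfl⟩ := Nat.exists_eq_succ_of_ne_zero (Nat.ne_zero_of_lt hij)
    exact (apply_succ_succ hA hi hj).trans (ih _ _ (by omega))

theorem apply_diag (hA : Commute A (boxJordan K n)) {k l : Fin r} {i : ℕ}
    (hk : i < n k) (hl : i < n l) :
    A ⟨k, ⟨i, hk⟩⟩ ⟨l, ⟨i, hl⟩⟩ = A ⟨k, ⟨0, by omega⟩⟩ ⟨l, ⟨0, by omega⟩⟩ := by
  induction i with
  | zero => rfl
  | succ i ih => exact (apply_succ_succ hA hk hl).trans (ih _ _)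

/-- Sliding down the diagonal reaches the last row of the block with a column still to its right.
The entry is thus one of `A * boxJordan`, in a row where `boxJordan * A` vanishes. -/
theorem apply_zero_zero_of_lt (hA : Commute A (boxJordan K n)) {k l : Fin r}
    (hk : 0 < n k) (hkl : n k < n l) : A ⟨k, ⟨0, hk⟩⟩ ⟨l, ⟨0, by omega⟩⟩ = 0 := by
  rw [← apply_diag hA (i := n k - 1) (by omega) (by omega)]
  have h := congrFun (congrFun hA.eq ⟨k, ⟨n k - 1, by omega⟩⟩) ⟨l, ⟨n k - 1 + 1, by omega⟩⟩
  rwa [mul_boxJordan_apply_succ, boxJordan_mul_apply,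
    dif_neg (by simp only; omega)] at h

/-- The first diagonal block is multiplicative on the centralizer of the Jordan matrix. -/
theorem mul_apply_zero_zero (hpos : ∀ k, 0 < n k) {B : Matrix (Box n) (Box n) K}
    (hB : Commute B (boxJordan K n)) (k l : Fin r) :
    (A * B) ⟨k, ⟨0, hpos k⟩⟩ ⟨l, ⟨0, hpos l⟩⟩ =
      ∑ p, A ⟨k, ⟨0, hpos k⟩⟩ ⟨p, ⟨0, hpos p⟩⟩ * B ⟨p, ⟨0, hpos p⟩⟩ ⟨l, ⟨0, hpos l⟩⟩ := by
  rw [Matrix.mul_apply, Fintype.sum_sigma]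
  refine Finset.sum_congr rfl fun p _ => ?_
  rw [Finset.sum_eq_single (⟨0, hpos p⟩ : Fin (n p))]
  · rintro ⟨i, hi⟩ - hne
    rw [apply_eq_zero_of_lt hB hi (hpos l) (Nat.pos_of_ne_zero fun h => hne (Fin.ext h)), mul_zero]
  · simp

/-- Each `G_j` is multiplicative on the centralizer of the Jordan matrix. -/
theorem mul_apply_rowAt (hpos : ∀ k, 0 < n k) {B : Matrix (Box n) (Box n) K}
    (hA : Commute A (boxJordan K n)) (hB : Commute B (boxJordan K n)) (j : Fin (numParts n))
    (a b : Fin (multiplicity n j)) :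
    (A * B) ⟨rowAt n j a, ⟨0, hpos _⟩⟩ ⟨rowAt n j b, ⟨0, hpos _⟩⟩ =
      ∑ c, A ⟨rowAt n j a, ⟨0, hpos _⟩⟩ ⟨rowAt n j c, ⟨0, hpos _⟩⟩ *
        B ⟨rowAt n j c, ⟨0, hpos _⟩⟩ ⟨rowAt n j b, ⟨0, hpos _⟩⟩ := by
  rw [mul_apply_zero_zero hpos hB]
  refine sum_eq_sum_rowAt n j (fun p => A ⟨rowAt n j a, ⟨0, hpos _⟩⟩ ⟨p, ⟨0, hpos p⟩⟩ *
    B ⟨p, ⟨0, hpos p⟩⟩ ⟨rowAt n j b, ⟨0, hpos _⟩⟩) fun p hp => ?_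
  -- A shorter row `p` kills the factor from `B`, a longer one the factor from `A`.
  rcases hp.lt_or_gt with h | h
  · rw [apply_zero_zero_of_lt hB (hpos p) (by rwa [length_rowAt n j b]), mul_zero]
  · rw [apply_zero_zero_of_lt hA (hpos _) (by rwa [length_rowAt n j a]), zero_mul]

/-- A matrix commuting with the Jordan matrix is nilpotent if all the `G_j` vanish. -/
theorem isNilpotent_of_rowAt_eq_zero (hpos : ∀ k, 0 < n k) (hA : Commute A (boxJordan K n))
    (h : ∀ j a b, A ⟨rowAt n j a, ⟨0, hpos _⟩⟩ ⟨rowAt n j b, ⟨0, hpos _⟩⟩ = 0) :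
    IsNilpotent A := by
  let c := Finset.univ.sup n
  have hc : ∀ k, n k ≤ c := fun k => Finset.le_sup (Finset.mem_univ k)
  -- Lexicographic order, column first and then decreasing length: the second term is at most `c`,
  -- so it never outweighs a step of one column.
  refine isNilpotent_of_weight A (fun x => x.2 * (c + 1) + (c - n x.1)) ?_
  rintro ⟨k, i, hi⟩ ⟨l, j, hj⟩ hne
  have hck := hc k
  have hcl := hc l
  have hij : i ≤ j := not_lt.1 fun hlt => hne (apply_eq_zero_of_lt hA hi hj hlt)
  simp only
  rcases hij.lt_or_eq with hlt | rfl
  · have : (i + 1) * (c + 1) ≤ j * (c + 1) := Nat.mul_le_mul_right _ hlt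
    rw [add_mul, one_mul] at this
    omega
  · rw [apply_diag hA hi hj] at hne
    have hlk : n l ≤ n k := not_lt.1 fun hlt => hne (apply_zero_zero_of_lt hA _ hlt)
    have hlk' : n l ≠ n k := by
      intro heq
      obtain ⟨m, hm⟩ := exists_distinctPart n k
      obtain ⟨a, rfl⟩ := exists_rowAt n m k hm
      obtain ⟨b, rfl⟩ := exists_rowAt n m l (heq.trans hm)
      exact hne (h m a b)
    omega

/-- The matrix with the scalar `g k l` on the diagonal of each square block. -/
def scalarBlocks (n : Fin r → ℕ) (g : Fin r → Fin r → K) : Matrix (Box n) (Box n) K :=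
  Matrix.of fun x y => if (x.2 : ℕ) = y.2 ∧ n x.1 = n y.1 then g x.1 y.1 else 0

/-- Nonzero blocks join rows of equal length, so the shift leaves both rows at the same column. -/
theorem commute_scalarBlocks (g : Fin r → Fin r → K) :
    Commute (scalarBlocks n g) (boxJordan K n) := by
  ext ⟨k, i, hi⟩ ⟨l, j, hj⟩
  rw [boxJordan_mul_apply]
  cases j with
  | zero =>
    rw [mul_boxJordan_apply_zero]
    simp [scalarBlocks]
  | succ j =>
    rw [mul_boxJordan_apply_succ]
    split_ifs with h
    · simp [scalarBlocks]
    · have : ¬(i = j ∧ n k = n l) := by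
        simp only at h
        omega
      simp [scalarBlocks, this]

end BoxMatrices

/-! ### Transport to an arbitrary conjugate of the Jordan matrix. -/

section Transport

variable {K : Type*} [Field K] {r : ℕ} (n : Fin r → ℕ)

/-- Conjugation by `P⁻¹`, followed by the passage to matrices indexed by the boxes. -/
def toBoxes (P : (Matrix (Fin (∑ k, n k)) (Fin (∑ k, n k)) K)ˣ) :
    Matrix (Fin (∑ k, n k)) (Fin (∑ k, n k)) K ≃ₐ[K] Matrix (Box n) (Box n) K :=
  (AlgEquiv.ofAlgHom
    { toFun := fun M => P⁻¹.val * M * P.val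
      map_one' := by simp
      map_mul' := fun M N => by simp [mul_assoc]
      map_zero' := by simp
      map_add' := fun M N => by rw [mul_add, add_mul]
      commutes' := fun c => by rw [← Algebra.commutes, mul_assoc, Units.inv_mul, mul_one] }
    { toFun := fun M => P.val * M * P⁻¹.val
      map_one' := by simp
      map_mul' := fun M N => by simp [mul_assoc]
      map_zero' := by simp
      map_add' := fun M N => by rw [mul_add, add_mul]
      commutes' := fun c => by rw [← Algebra.commutes, mul_assoc, Units.mul_inv, mul_one] }
    (by ext1 M; simp [mul_assoc]) (by ext1 M; simp [mul_assoc])).trans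
    (Matrix.reindexAlgEquiv K K (horizontal n).symm)

variable (P : (Matrix (Fin (∑ k, n k)) (Fin (∑ k, n k)) K)ˣ)

theorem toBoxes_apply (M : Matrix (Fin (∑ k, n k)) (Fin (∑ k, n k)) K) (x y : Box n) :
    toBoxes n P M x y = (P⁻¹.val * M * P.val) (horizontal n x) (horizontal n y) := rfl

theorem toBoxes_jordan :
    toBoxes n P (P.val * jordanMatrix K n * P⁻¹.val) = boxJordan K n := by
  ext x y
  have h : P⁻¹.val * (P.val * jordanMatrix K n * P⁻¹.val) * P.val = jordanMatrix K n := by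
    simp only [mul_assoc, Units.inv_mul, mul_one, Units.inv_mul_cancel_left]
  rw [toBoxes_apply, h]
  simp only [jordanMatrix, boxJordan, Matrix.of_apply]
  rw [Equiv.symm_apply_apply, Equiv.symm_apply_apply]

theorem mem_commutatorAlgebra_iff (M : Matrix (Fin (∑ k, n k)) (Fin (∑ k, n k)) K) :
    M ∈ commutatorAlgebra (P.val * jordanMatrix K n * P⁻¹.val) ↔
      Commute (toBoxes n P M) (boxJordan K n) := by
  rw [Subalgebra.mem_centralizer_iff, ← toBoxes_jordan n P, commute_iff_eq, ← map_mul, ← map_mul,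
    (toBoxes n P).injective.eq_iff]
  simp [eq_comm]

theorem fineBlock_apply (hpos : ∀ k, 0 < n k) (M : Matrix (Fin (∑ k, n k)) (Fin (∑ k, n k)) K)
    (j : Fin (numParts n)) (a b : Fin (multiplicity n j)) :
    fineBlock n hpos (P⁻¹.val * M * P.val) j a b =
      toBoxes n P M ⟨rowAt n j a, ⟨0, hpos _⟩⟩ ⟨rowAt n j b, ⟨0, hpos _⟩⟩ := rfl

/-- The homomorphism `M ↦ (G_1(P⁻¹MP), …, G_s(P⁻¹MP))` on the commutator algebra. -/
def fineBlocksHom (hpos : ∀ k, 0 < n k) :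
    commutatorAlgebra (P.val * jordanMatrix K n * P⁻¹.val) →ₐ[K]
      ((j : Fin (numParts n)) → Matrix (Fin (multiplicity n j)) (Fin (multiplicity n j)) K) :=
  AlgHom.ofLinearMap
    { toFun := fun M j => fineBlock n hpos
        (P⁻¹.val * (M : Matrix (Fin (∑ k, n k)) (Fin (∑ k, n k)) K) * P.val) j
      map_add' := fun M N => by
        ext j a b
        simp only [Pi.add_apply, Matrix.add_apply, fineBlock_apply, Subalgebra.coe_add, map_add]
      map_smul' := fun c M => by
        ext j a b
        simp only [Pi.smul_apply, Matrix.smul_apply, fineBlock_apply, Subalgebra.coe_smul,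
          map_smul, RingHom.id_apply] }
    (by
      ext j a b
      simp only [LinearMap.coe_mk, AddHom.coe_mk, fineBlock_apply, OneMemClass.coe_one, map_one,
        Pi.one_apply, Matrix.one_apply]
      refine if_congr ⟨fun h => ?_, fun h => by rw [h]⟩ rfl rfl
      exact rowAt_injective n j (congrArg Sigma.fst h))
    (fun M N => by
      ext j a b
      simp only [LinearMap.coe_mk, AddHom.coe_mk, fineBlock_apply, MulMemClass.coe_mul, map_mul,
        Pi.mul_apply, Matrix.mul_apply]
      exact mul_apply_rowAt hpos ((mem_commutatorAlgebra_iff n P _).1 M.2)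
        ((mem_commutatorAlgebra_iff n P _).1 N.2) j a b)

theorem fineBlocksHom_apply (hpos : ∀ k, 0 < n k)
    (M : commutatorAlgebra (P.val * jordanMatrix K n * P⁻¹.val)) (j : Fin (numParts n)) :
    fineBlocksHom n P hpos M j = fineBlock n hpos
      (P⁻¹.val * (M : Matrix (Fin (∑ k, n k)) (Fin (∑ k, n k)) K) * P.val) j := rfl

theorem fineBlocksHom_surjective (hpos : ∀ k, 0 < n k) :
    Function.Surjective (fineBlocksHom n P hpos) := by
  intro G
  obtain ⟨g, hg⟩ := exists_array n G
  refine ⟨⟨(toBoxes n P).symm (scalarBlocks n g), ?_⟩, ?_⟩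
  · rw [mem_commutatorAlgebra_iff, AlgEquiv.apply_symm_apply]
    exact commute_scalarBlocks g
  · ext j a b
    rw [fineBlocksHom_apply, fineBlock_apply, AlgEquiv.apply_symm_apply, ← hg]
    simp [scalarBlocks, length_rowAt]

theorem isNilpotent_of_fineBlocksHom_eq_zero (hpos : ∀ k, 0 < n k)
    (M : commutatorAlgebra (P.val * jordanMatrix K n * P⁻¹.val))
    (hM : fineBlocksHom n P hpos M = 0) : IsNilpotent M := by
  obtain ⟨m, hm⟩ := isNilpotent_of_rowAt_eq_zero hpos ((mem_commutatorAlgebra_iff n P _).1 M.2)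
    fun j a b => by
      rw [← fineBlock_apply, ← fineBlocksHom_apply, hM]
      rfl
  -- Nilpotency descends to the subalgebra because `toBoxes` and the inclusion are injective.
  refine ⟨m, Subtype.ext ((toBoxes n P).injective ?_)⟩
  simpa using hm

end Transport

end JordanCommutator

theorem mainTheorem4 {K : Type*} [Field K] {r : ℕ} (n : Fin r → ℕ)
    (hn : Antitone n) (hpos : ∀ k, 0 < n k)
    (J : Matrix (Fin (∑ k, n k)) (Fin (∑ k, n k)) K)
    (P : (Matrix (Fin (∑ k, n k)) (Fin (∑ k, n k)) K)ˣ)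
    (hJ : J = P.val * JordanCommutator.jordanMatrix K n * P⁻¹.val) :
    ∃ Φ : JordanCommutator.commutatorAlgebra J →ₐ[K]
        ((j : Fin (JordanCommutator.numParts n)) →
          Matrix (Fin (JordanCommutator.multiplicity n j))
            (Fin (JordanCommutator.multiplicity n j)) K),
      (∀ (M : JordanCommutator.commutatorAlgebra J) (j : Fin (JordanCommutator.numParts n)),
        Φ M j = JordanCommutator.fineBlock n hpos
          (P⁻¹.val * (M : Matrix (Fin (∑ k, n k)) (Fin (∑ k, n k)) K) * P.val) j) ∧
      Function.Surjective Φ ∧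
      RingHom.ker Φ = Ring.jacobson (JordanCommutator.commutatorAlgebra J) := by
  subst hJ
  have (j : Fin (JordanCommutator.numParts n)) :
      IsSemisimpleRing (Matrix (Fin (JordanCommutator.multiplicity n j))
        (Fin (JordanCommutator.multiplicity n j)) K) := inferInstance
  exact ⟨JordanCommutator.fineBlocksHom n P hpos,
    JordanCommutator.fineBlocksHom_apply n P hpos,
    JordanCommutator.fineBlocksHom_surjective n P hpos,
    JordanCommutator.ker_eq_ringJacobson (JordanCommutator.fineBlocksHom n P hpos).toRingHom
      (JordanCommutator.fineBlocksHom_surjective n P hpos)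
      (JordanCommutator.isNilpotent_of_fineBlocksHom_eq_zero n P hpos)⟩
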